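/- Let $k$ be a field with $\operatorname{char} k \neq 2$, let $n \ge 2$, and let $R = k[x_{i,j} : 1 \le i < j \le n+1]$ be the polynomial ring over $k$ in $n(n+1)/2$ indeterminates. Put $x_{j,i} = x_{i,j}$ for $i<j$ and $x_{j,j} = 0$. Let $M \in R$ be the Cayley–Menger determinant, that is, the determinant of the $(n+2)\times(n+2)$ matrix $(c_{i,j})_{0 \le i,j \le n+1}$ with $$c_{i,j} = \begin{cases} 0 & \text{if } i = j,\\ 1 & \text{if } i \ne j \text{ and } ij = 0,\\ x_{i,j}^2 & \text{otherwise.}\end{cases}$$ Then: (i) $M$ is non-zero and homogeneous of degree $2n$. (ii) $M$ is reducible in $R$ (that is, non-zero and a product of two non-units of $R$) if and only if $n = 2$. For $n = 2$, writing $z = x_{1,2}$, $x = x_{2,3}$, $y = x_{1,3}$, one has $$M = \begin{vmatrix} 0&1&1&1\\ 1&0&z^2&y^2\\ 1&z^2&0&x^2\\ 1&y^2&x^2&0\end{vmatrix} = -(x+y+z)(-x+y+z)(x-y+z)(x+y-z).$$ -/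

import Mathlib

/-- Index set of the indeterminates `x_{ij}`, one for each pair `i < j` of the `m` indices
(numbered `0, …, m - 1` instead of `1, …, m`). -/
abbrev EdgeIndex (m : ℕ) : Type := {p : Fin m × Fin m // p.1 < p.2}

noncomputable section

/-- The indeterminate `x_{i,j}`, with the conventions `x_{i,j} = x_{j,i}` and `x_{j,j} = 0`. -/
def edgeVar (k : Type*) [Field k] {m : ℕ} (i j : Fin m) : MvPolynomial (EdgeIndex m) k :=
  if h : i < j then MvPolynomial.X ⟨(i, j), h⟩
  else if h' : j < i then MvPolynomial.X ⟨(j, i), h'⟩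
  else 0

/-- The `(n+2) × (n+2)` Cayley-Menger matrix, rows and columns numbered `0, …, n+1`:
`0` on the diagonal, `1` in the rest of row `0` and column `0`, squared edge variables elsewhere.
`Fin.pred` turns the index `i ∈ {1, …, n+1}` of a vertex into an element of `Fin (n + 1)`. -/
def cayleyMengerMatrix (k : Type*) [Field k] (n : ℕ) :
    Matrix (Fin (n + 2)) (Fin (n + 2)) (MvPolynomial (EdgeIndex (n + 1)) k) :=
  Matrix.of fun i j =>
    if i = j then 0
    else if h : i = 0 ∨ j = 0 then 1
    else edgeVar k (i.pred fun hi => h (Or.inl hi)) (j.pred fun hj => h (Or.inr hj)) ^ 2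

/-- The Cayley-Menger determinant of the generic `n`-simplex. -/
def cayleyMenger (k : Type*) [Field k] (n : ℕ) : MvPolynomial (EdgeIndex (n + 1)) k :=
  (cayleyMengerMatrix k n).det

end

/-- A reducible element: non-zero, and a product of two non-units. -/
def IsReducible {R : Type*} [CommRing R] (p : R) : Prop :=
  p ≠ 0 ∧ ∃ f g : R, ¬ IsUnit f ∧ ¬ IsUnit g ∧ p = f * g

/-! Irreducibility for n ≥ 3 is by induction, merging two vertices into one point while keeping
their mutual edge as a variable t. Two rows and columns of the determinant then agree apart from t²,
and M becomes -t²P with P = 2M' + t²M'', where M' belongs to the simplex with one vertex fewer and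
M'' to its facet omitting the merged point (`rename_contract_cayleyMenger`). As a quadratic in t, P
is irreducible by Eisenstein: at M' when M' is irreducible, at the perimeter factor of Heron's
formula when M' is the triangle's polynomial.

If M = fg with f non-constant and deg f ≤ deg g, then deg f < deg P, so the image of f divides t².
Contraction loses no degree, so this image is an associate of t or t². This holds for every
contracted edge. Apply it to two disjoint edges and evaluate f at the indicator of the first: its
own contraction gives a non-zero value, the other gives zero, a contradiction. -/

open Matrix

/-! ### Bordered determinants and the doubling of a vertex -/

section Bordered

variable {S T : Type*} [CommRing S] [CommRing T]

/-- The matrix `a` bordered by a row and a column of ones, with `0` in the corner. -/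
def bordered {m : ℕ} (a : Fin m → Fin m → S) : Matrix (Fin (m + 1)) (Fin (m + 1)) S :=
  Matrix.of (Fin.cons (Fin.cons 0 fun _ => 1) fun i => Fin.cons 1 (a i))

@[simp] lemma bordered_zero_zero {m : ℕ} (a : Fin m → Fin m → S) : bordered a 0 0 = 0 := rfl

@[simp] lemma bordered_zero_succ {m : ℕ} (a : Fin m → Fin m → S) (j : Fin m) :
    bordered a 0 j.succ = 1 := rfl

@[simp] lemma bordered_succ_zero {m : ℕ} (a : Fin m → Fin m → S) (i : Fin m) :
    bordered a i.succ 0 = 1 := rfl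

@[simp] lemma bordered_succ_succ {m : ℕ} (a : Fin m → Fin m → S) (i j : Fin m) :
    bordered a i.succ j.succ = a i j := rfl

lemma map_det_bordered {m : ℕ} (φ : S →+* T) (a : Fin m → Fin m → S) :
    φ (bordered a).det = (bordered fun i j => φ (a i j)).det := by
  rw [RingHom.map_det]
  congr 1
  ext i j
  cases i using Fin.cases <;> cases j using Fin.cases <;> simp

lemma det_bordered_perm {m : ℕ} (τ : Equiv.Perm (Fin m)) (a : Fin m → Fin m → S) :
    (bordered fun i j => a (τ i) (τ j)).det = (bordered a).det := by
  rw [← det_submatrix_equiv_self (Equiv.Perm.decomposeFin.symm (0, τ)) (bordered a)]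
  congr 1
  ext i j
  cases i using Fin.cases <;> cases j using Fin.cases <;> simp

/-- The matrix `N` with a copy of its row and column `0` added, where the original and
the copy have mutual entry `t`. -/
def duplicate {l : ℕ} (N : Matrix (Fin (l + 1)) (Fin (l + 1)) S) (t : S) :
    Matrix (Fin (l + 2)) (Fin (l + 2)) S :=
  Matrix.of (Fin.cons (Fin.cons 0 (Fin.cons t fun j => N 0 j.succ))
    fun i => Fin.cons ((Fin.cons t fun i => N i.succ 0 : Fin (l + 1) → S) i) (N i))

/-- Subtracting row 1 from row 0, and likewise for columns, leaves (-2t, t, 0, …, 0) as row and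
column 0; expansion along these gives the formula. -/
lemma det_duplicate {l : ℕ} (N : Matrix (Fin (l + 1)) (Fin (l + 1)) S) (hN : N 0 0 = 0) (t : S) :
    (duplicate N t).det = -(t * (2 * N.det + t * (N.submatrix Fin.succ Fin.succ).det)) := by
  set A := duplicate N t
  have hrow : A.det = (A.updateRow 0 (A 0 + (-1 : S) • A (Fin.succ 0))).det :=
    (det_updateRow_add_smul_self A (by simp) _).symm
  set B := A.updateRow 0 (A 0 + (-1 : S) • A (Fin.succ 0)) with hB
  have hcol : B.det = (B.updateCol 0 (fun k => B k 0 + (-1 : S) • B k (Fin.succ 0))).det :=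
    (det_updateCol_add_smul_self B (by simp) _).symm
  set C := B.updateCol 0 (fun k => B k 0 + (-1 : S) • B k (Fin.succ 0)) with hC
  have d00 : A 0 0 = 0 := rfl
  have d01 : A 0 (Fin.succ 0) = t := rfl
  have d02 (j : Fin l) : A 0 j.succ.succ = N 0 j.succ := rfl
  have d10 : A (Fin.succ 0) 0 = t := rfl
  have d20 (i : Fin l) : A i.succ.succ 0 = N i.succ 0 := rfl
  have d11 (i j : Fin (l + 1)) : A i.succ j.succ = N i j := rfl
  have h00 : C 0 0 = -2 * t := by
    simp [hC, hB, updateRow_apply, d00, d01, d10, d11, hN,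
      -Fin.succ_zero_eq_one, -Fin.succ_zero_eq_one']
    ring
  have h01 : C 0 (Fin.succ 0) = t := by
    simp [hC, hB, updateRow_apply, d01, d11, hN,
      -Fin.succ_zero_eq_one, -Fin.succ_zero_eq_one']
  have h02 (j : Fin l) : C 0 j.succ.succ = 0 := by
    simp [hC, hB, updateRow_apply, d02, d11,
      -Fin.succ_zero_eq_one, -Fin.succ_zero_eq_one']
  have h10 : C (Fin.succ 0) 0 = t := by
    simp [hC, hB, updateRow_apply, d10, d11, hN,
      -Fin.succ_zero_eq_one, -Fin.succ_zero_eq_one']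
  have h20 (i : Fin l) : C i.succ.succ 0 = 0 := by
    simp [hC, hB, updateRow_apply, d20, d11,
      -Fin.succ_zero_eq_one, -Fin.succ_zero_eq_one']
  have h11 (i j : Fin (l + 1)) : C i.succ j.succ = N i j := by
    simp [hC, hB, updateRow_apply, d11]
  have hminor : (C.submatrix Fin.succ (Fin.succAbove (Fin.succ 0))).det
      = t * (N.submatrix Fin.succ Fin.succ).det := by
    rw [det_succ_column_zero, Fin.sum_univ_succ, Finset.sum_eq_zero]
    · have : (C.submatrix Fin.succ (Fin.succAbove (Fin.succ 0))).submatrix (Fin.succAbove 0) Fin.succ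
          = N.submatrix Fin.succ Fin.succ := by
        ext i j
        simp [← h11]
      rw [this]
      simp [h10, -Fin.succ_zero_eq_one, -Fin.succ_zero_eq_one']
    · intro i _
      simp [h20]
  rw [hrow, hcol, det_succ_row_zero, Fin.sum_univ_succ, Fin.sum_univ_succ, Finset.sum_eq_zero]
  · have : C.submatrix Fin.succ (Fin.succAbove 0) = N := by
      ext i j
      simp [h11]
    rw [this, hminor, h00, h01]
    simp
    ring
  · intro i _
    simp [h02]

/-- Splitting the first vertex of a configuration into two vertices with mutual entry `s`. -/
def splitFirst {q : ℕ} (a : Fin (q + 1) → Fin (q + 1) → S) (s : S) (i j : Fin (q + 2)) : S :=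
  if Fin.predAbove 0 i = Fin.predAbove 0 j then (if i = j then 0 else s)
  else a (Fin.predAbove 0 i) (Fin.predAbove 0 j)

lemma det_bordered_splitFirst {q : ℕ} (a : Fin (q + 1) → Fin (q + 1) → S)
    (ha : ∀ i, a i i = 0) (s : S) :
    (bordered (splitFirst a s)).det =
      -(s * (2 * (bordered a).det + s * (bordered fun i j : Fin q => a i.succ j.succ).det)) := by
  -- `duplicate` wants the two copies at indices 0 and 1, but the border occupies index 0. Here σ
  -- moves the border to index 2, and ρ moves it to index 1 in the smaller matrix.
  let σ : Equiv.Perm (Fin (q + 3)) := Equiv.swap 0 (Fin.succ 0) * Equiv.swap (Fin.succ 0) (Fin.succ (Fin.succ 0))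
  have h0 : σ 0 = Fin.succ 0 := by
    simp [σ, Equiv.swap_apply_def, (Fin.succ_ne_zero _).symm,
      -Fin.succ_zero_eq_one, -Fin.succ_zero_eq_one']
  have h1 : σ (Fin.succ 0) = Fin.succ (Fin.succ 0) := by
    simp [σ, Equiv.swap_apply_def, Fin.succ_ne_zero,
      -Fin.succ_zero_eq_one, -Fin.succ_zero_eq_one']
  have h2 : σ (Fin.succ (Fin.succ 0)) = 0 := by
    simp [σ, -Fin.succ_zero_eq_one, -Fin.succ_zero_eq_one']
  have h3 (i : Fin q) : σ i.succ.succ.succ = i.succ.succ.succ := by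
    simp [σ, Equiv.swap_apply_def, Fin.succ_ne_zero,
      -Fin.succ_zero_eq_one, -Fin.succ_zero_eq_one']
  let ρ : Equiv.Perm (Fin (q + 2)) := Equiv.swap 0 (Fin.succ 0)
  have r0 : ρ 0 = Fin.succ 0 := by simp [ρ, -Fin.succ_zero_eq_one, -Fin.succ_zero_eq_one']
  have r1 : ρ (Fin.succ 0) = 0 := by simp [ρ, -Fin.succ_zero_eq_one, -Fin.succ_zero_eq_one']
  have r2 (i : Fin q) : ρ i.succ.succ = i.succ.succ := by
    simp [ρ, Equiv.swap_apply_def, Fin.succ_ne_zero,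
      -Fin.succ_zero_eq_one, -Fin.succ_zero_eq_one']
  have key : (bordered (splitFirst a s)).submatrix σ σ
      = duplicate ((bordered a).submatrix ρ ρ) s := by
    have p0 : Fin.predAbove 0 (0 : Fin (q + 2)) = 0 := rfl
    have p1 (i : Fin (q + 1)) : Fin.predAbove 0 i.succ = i := Fin.predAbove_zero_succ
    have e00 : duplicate ((bordered a).submatrix ρ ρ) s 0 0 = 0 := rfl
    have e01 : duplicate ((bordered a).submatrix ρ ρ) s 0 (Fin.succ 0) = s := rfl
    have e02 (j : Fin (q + 1)) : duplicate ((bordered a).submatrix ρ ρ) s 0 j.succ.succ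
        = bordered a (ρ 0) (ρ j.succ) := rfl
    have e10 : duplicate ((bordered a).submatrix ρ ρ) s (Fin.succ 0) 0 = s := rfl
    have e20 (i : Fin (q + 1)) : duplicate ((bordered a).submatrix ρ ρ) s i.succ.succ 0
        = bordered a (ρ i.succ) (ρ 0) := rfl
    have e11 (i j : Fin (q + 2)) : duplicate ((bordered a).submatrix ρ ρ) s i.succ j.succ
        = bordered a (ρ i) (ρ j) := rfl
    have hs (i : Fin q) : (0 : Fin (q + 1)) ≠ i.succ := (Fin.succ_ne_zero i).symm
    ext i j
    cases i using Fin.cases with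
    | zero =>
      cases j using Fin.cases with
      | zero => simp [h0, e00, splitFirst, -Fin.succ_zero_eq_one, -Fin.succ_zero_eq_one']
      | succ j =>
      cases j using Fin.cases with
      | zero =>
        simp [h0, h1, e01, splitFirst, p0, p1, (Fin.succ_ne_zero _).symm,
          -Fin.succ_zero_eq_one, -Fin.succ_zero_eq_one']
      | succ j =>
      cases j using Fin.cases with
      | zero =>
        simp [h0, h2, e02, r0, r1, -Fin.succ_zero_eq_one, -Fin.succ_zero_eq_one']
      | succ j =>
        simp [h0, h3, e02, r0, r2, splitFirst, p0, p1, hs,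
          -Fin.succ_zero_eq_one, -Fin.succ_zero_eq_one']
    | succ i =>
    cases j using Fin.cases with
    | zero =>
      cases i using Fin.cases with
      | zero =>
        simp [h0, h1, e10, splitFirst, p0, p1,
          -Fin.succ_zero_eq_one, -Fin.succ_zero_eq_one']
      | succ i =>
      cases i using Fin.cases with
      | zero =>
        simp [h0, h2, e20, r0, r1, -Fin.succ_zero_eq_one, -Fin.succ_zero_eq_one']
      | succ i =>
        simp [h0, h3, e20, r0, r2, splitFirst, p0, p1,
          -Fin.succ_zero_eq_one, -Fin.succ_zero_eq_one']
    | succ j =>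
      rw [e11, submatrix_apply]
      have hσ (i : Fin (q + 2)) :
          (i = Fin.succ 0 ∧ σ i.succ = 0 ∧ ρ i = 0) ∨
            ∃ v : Fin (q + 1), σ i.succ = v.succ.succ ∧ ρ i = v.succ := by
        cases i using Fin.cases with
        | zero => exact Or.inr ⟨0, h1, r0⟩
        | succ i =>
        cases i using Fin.cases with
        | zero => exact Or.inl ⟨rfl, h2, r1⟩
        | succ i => exact Or.inr ⟨i.succ, h3 i, r2 i⟩
      rcases hσ i with ⟨-, hi, hi'⟩ | ⟨v, hi, hi'⟩ <;>
      rcases hσ j with ⟨-, hj, hj'⟩ | ⟨w, hj, hj'⟩ <;> rw [hi, hi', hj, hj'] <;>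
      simp [splitFirst, p1]
      rintro rfl
      simp [ha]
  rw [← det_submatrix_equiv_self σ, key, det_duplicate _ (by rw [submatrix_apply, r0]; exact ha 0),
    det_submatrix_equiv_self]
  have : ((bordered a).submatrix ρ ρ).submatrix Fin.succ Fin.succ
      = bordered fun i j : Fin q => a i.succ j.succ := by
    ext i j
    cases i using Fin.cases <;> cases j using Fin.cases <;>
      simp [r1, r2, -Fin.succ_zero_eq_one, -Fin.succ_zero_eq_one']
  rw [this]

end Bordered

/-! ### Contraction of an edge, non-vanishing and degree -/

section Contraction

open MvPolynomial

variable (k : Type*) [Field k]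

@[simp] lemma edgeVar_self {m : ℕ} (i : Fin m) : edgeVar k i i = 0 := by
  simp [edgeVar]

lemma edgeVar_of_lt {m : ℕ} {i j : Fin m} (h : i < j) : edgeVar k i j = X ⟨(i, j), h⟩ := by
  simp [edgeVar, h]

lemma edgeVar_comm {m : ℕ} (i j : Fin m) : edgeVar k i j = edgeVar k j i := by
  rcases lt_trichotomy i j with h | rfl | h
  · simp [edgeVar, h, h.asymm]
  · rfl
  · simp [edgeVar, h, h.asymm]

lemma cayleyMenger_eq (n : ℕ) :
    cayleyMenger k n = (bordered fun i j : Fin (n + 1) => edgeVar k i j ^ 2).det := by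
  rw [cayleyMenger]
  congr 1
  ext1 i j
  cases i using Fin.cases with
  | zero => cases j using Fin.cases <;> simp [cayleyMengerMatrix, (Fin.succ_ne_zero _).symm]
  | succ i =>
    cases j using Fin.cases with
    | zero => simp [cayleyMengerMatrix]
    | succ j =>
      by_cases h : i = j
      · simp [cayleyMengerMatrix, h]
      · simp [cayleyMengerMatrix, h]

/-- The image of an edge under a map of vertices, `none` if the edge is contracted to a point. -/
def edgeMap {m l : ℕ} (f : Fin m → Fin l) (e : EdgeIndex m) : Option (EdgeIndex l) :=
  if h : f e.1.1 < f e.1.2 then some ⟨(f e.1.1, f e.1.2), h⟩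
  else if h : f e.1.2 < f e.1.1 then some ⟨(f e.1.2, f e.1.1), h⟩
  else none

lemma rename_edgeMap_edgeVar {m l : ℕ} (f : Fin m → Fin l) (i j : Fin m) :
    rename (edgeMap f) (edgeVar k i j) =
      if f i = f j then (if i = j then 0 else X none)
      else rename some (edgeVar k (f i) (f j)) := by
  wlog h : i < j generalizing i j
  · rcases (not_lt.1 h).eq_or_lt with rfl | h
    · simp
    · rw [edgeVar_comm, this j i h, edgeVar_comm k (f i)]
      simp only [eq_comm]
  rw [edgeVar_of_lt k h, rename_X]
  rcases lt_trichotomy (f i) (f j) with h' | h' | h'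
  · simp [edgeMap, h', h'.ne, edgeVar_of_lt]
  · simp [edgeMap, h', h.ne]
  · simp [edgeMap, h', h'.asymm, h'.ne', edgeVar_comm k (f i), edgeVar_of_lt]

/-- The Cayley-Menger polynomial of the last `q + 1` among `q + 2` vertices. -/
noncomputable def facetCayleyMenger (q : ℕ) : MvPolynomial (EdgeIndex (q + 2)) k :=
  (bordered fun i j : Fin (q + 1) => edgeVar k i.succ j.succ ^ 2).det

/-- The non-trivial factor of the image of a Cayley-Menger polynomial under contraction of
an edge. -/
noncomputable def contractedFactor (q : ℕ) : MvPolynomial (Option (EdgeIndex (q + 2))) k :=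
  2 * rename some (cayleyMenger k (q + 1)) + X none ^ 2 * rename some (facetCayleyMenger k q)

/-- `Fin.predAbove 0` identifies 0 and 1, so τ selects which two vertices merge; the result is
`splitFirst` with s = t², up to relabelling. -/
lemma rename_contract_cayleyMenger (q : ℕ) (τ : Equiv.Perm (Fin (q + 3))) :
    rename (edgeMap fun i => Fin.predAbove 0 (τ i)) (cayleyMenger k (q + 2)) =
      -(X none ^ 2 * contractedFactor k q) := by
  have h := det_bordered_splitFirst
    (fun i j : Fin (q + 2) => rename some (edgeVar k i j ^ 2)) (by simp)
    (X none ^ 2 : MvPolynomial (Option (EdgeIndex (q + 2))) k)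
  rw [← det_bordered_perm τ] at h
  have h1 := map_det_bordered (rename some : MvPolynomial (EdgeIndex (q + 2)) k →ₐ[k]
    MvPolynomial (Option (EdgeIndex (q + 2))) k).toRingHom (fun i j => edgeVar k i j ^ 2)
  have h2 := map_det_bordered (rename some : MvPolynomial (EdgeIndex (q + 2)) k →ₐ[k]
    MvPolynomial (Option (EdgeIndex (q + 2))) k).toRingHom
    (fun i j : Fin (q + 1) => edgeVar k i.succ j.succ ^ 2)
  have h3 := map_det_bordered (rename (edgeMap fun i => Fin.predAbove 0 (τ i)) :
    MvPolynomial (EdgeIndex (q + 3)) k →ₐ[k]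
    MvPolynomial (Option (EdgeIndex (q + 2))) k).toRingHom (fun i j => edgeVar k i j ^ 2)
  simp only [AlgHom.toRingHom_eq_coe, RingHom.coe_coe] at h1 h2 h3
  rw [contractedFactor, facetCayleyMenger, cayleyMenger_eq, cayleyMenger_eq, h1, h2, h3, ← h]
  congr 2
  ext1 i
  ext1 j
  rw [map_pow, rename_edgeMap_edgeVar, splitFirst]
  split_ifs <;> simp_all

lemma facetCayleyMenger_eq_rename (q : ℕ) :
    ∃ g : EdgeIndex (q + 1) → EdgeIndex (q + 2), Function.Injective g ∧
      facetCayleyMenger k q = rename g (cayleyMenger k q) := by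
  refine ⟨fun e => ⟨(e.1.1.succ, e.1.2.succ), Fin.succ_lt_succ_iff.2 e.2⟩, ?_, ?_⟩
  · rintro ⟨⟨a, b⟩, h⟩ ⟨⟨c, d⟩, h'⟩ H
    simpa using H
  · have h1 := map_det_bordered (rename (fun e : EdgeIndex (q + 1) =>
      (⟨(e.1.1.succ, e.1.2.succ), Fin.succ_lt_succ_iff.2 e.2⟩ : EdgeIndex (q + 2))) :
      MvPolynomial (EdgeIndex (q + 1)) k →ₐ[k] MvPolynomial (EdgeIndex (q + 2)) k).toRingHom
      (fun i j => edgeVar k i j ^ 2)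
    simp only [AlgHom.toRingHom_eq_coe, RingHom.coe_coe] at h1
    rw [cayleyMenger_eq, h1, facetCayleyMenger]
    congr 2
    ext1 i
    ext1 j
    rw [map_pow]
    congr 1
    rcases lt_trichotomy i j with h | rfl | h
    · simp [edgeVar_of_lt, h]
    · simp
    · rw [edgeVar_comm, edgeVar_comm k i]
      simp [edgeVar_of_lt, h]

/-- The contracted factor as a polynomial in the length of the contracted edge. -/
lemma optionEquivLeft_contractedFactor (q : ℕ) :
    optionEquivLeft k _ (contractedFactor k q) =
      Polynomial.C (facetCayleyMenger k q) * Polynomial.X ^ 2 +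
        Polynomial.C (2 * cayleyMenger k (q + 1)) := by
  have h (p : MvPolynomial (EdgeIndex (q + 2)) k) :
      optionEquivLeft k _ (rename some p) = Polynomial.C p := by
    induction p using MvPolynomial.induction_on with
    | C a => simp
    | add p q hp hq => simp [hp, hq]
    | mul_X p i hp => simp [hp]
  simp [contractedFactor, h, two_mul]
  ring

variable {k}

lemma cayleyMenger_ne_zero (h2 : (2 : k) ≠ 0) (n : ℕ) : cayleyMenger k n ≠ 0 := by
  induction n using Nat.twoStepInduction with
  | zero =>
    rw [cayleyMenger_eq, det_fin_two]
    have : (1 : Fin 2) = Fin.succ 0 := rfl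
    rw [this]
    simp only [bordered_zero_zero, bordered_zero_succ, bordered_succ_zero, bordered_succ_succ]
    simp
  | one =>
    intro h
    have h' := congrArg (eval fun _ => (1 : k)) h
    have := map_det_bordered (eval fun _ : EdgeIndex 2 => (1 : k)) (fun i j => edgeVar k i j ^ 2)
    rw [cayleyMenger_eq, this, det_fin_three] at h'
    have e1 : (1 : Fin 3) = Fin.succ 0 := rfl
    have e2 : (2 : Fin 3) = Fin.succ 1 := rfl
    rw [e1, e2] at h'
    simp only [bordered_zero_zero, bordered_zero_succ, bordered_succ_zero, bordered_succ_succ] at h'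
    simp [edgeVar] at h'
    apply h2
    linear_combination h'
  | more q hq _ =>
    intro h
    have h' := rename_contract_cayleyMenger k q 1
    rw [h, map_zero, eq_comm, neg_eq_zero, mul_eq_zero, or_iff_right (pow_ne_zero 2 (X_ne_zero _))]
      at h'
    -- The t² coefficient is the polynomial of a simplex two dimensions lower, hence the two-step
    -- induction.
    have h3 := congrArg (fun p => (optionEquivLeft k _ p).coeff 2) h'
    simp [optionEquivLeft_contractedFactor] at h3
    obtain ⟨g, hg, e⟩ := facetCayleyMenger_eq_rename k q
    rw [e] at h3
    exact hq (rename_injective g hg (by simpa [Polynomial.coeff_C] using h3))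

variable (k)

lemma isHomogeneous_cayleyMenger (n : ℕ) : (cayleyMenger k n).IsHomogeneous (2 * n) := by
  rw [cayleyMenger_eq, det_apply]
  refine IsHomogeneous.sum _ _ _ fun σ _ => ?_
  by_cases h0 : σ 0 = 0
  · rw [Finset.prod_eq_zero (Finset.mem_univ 0) (by simp [h0]), smul_zero]
    exact isHomogeneous_zero _ _ _
  let d (i : Fin (n + 2)) : ℕ := if i = 0 ∨ σ i = 0 then 0 else 2
  have hd : ∑ i, d i = 2 * n := by
    -- Exactly two factors come from the border, at the distinct indices 0 and σ⁻¹ 0; each of the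
    -- other n has degree 2.
    have hs : ∀ i, d i + ((if i = 0 then 2 else 0) + (if i = σ.symm 0 then 2 else 0)) = 2 := by
      intro i
      by_cases hi : i = 0
      · have : 0 ≠ σ.symm 0 := fun h => h0 (σ.eq_symm_apply.1 h)
        simp [d, hi, this]
      · by_cases hi' : i = σ.symm 0
        · subst hi'
          simp [d, hi]
        · have : σ i ≠ 0 := fun h => hi' (by simp [← h])
          simp [d, hi, hi', this]
    have := Finset.sum_congr rfl fun i (_ : i ∈ Finset.univ) => hs i
    rw [Finset.sum_add_distrib, Finset.sum_add_distrib] at this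
    simp at this
    omega
  have hprod : (∏ i, bordered (fun i j : Fin (n + 1) => edgeVar k i j ^ 2) (σ i) i).IsHomogeneous
      (2 * n) := by
    rw [← hd]
    refine IsHomogeneous.prod _ _ _ fun i _ => ?_
    have hedge (v w : Fin (n + 1)) : (edgeVar k v w ^ 2).IsHomogeneous 2 := by
      have : (edgeVar k v w).IsHomogeneous 1 := by
        rw [edgeVar]
        split_ifs
        exacts [isHomogeneous_X _ _, isHomogeneous_X _ _, isHomogeneous_zero _ _ _]
      simpa using this.pow 2
    generalize hv : σ i = v
    have hdi : d i = if i = 0 ∨ v = 0 then 0 else 2 := by simp [d, hv]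
    rw [hdi]
    cases i using Fin.cases <;> cases v using Fin.cases
    · simpa using isHomogeneous_zero _ _ _
    · simpa using isHomogeneous_one _ _
    · simpa using isHomogeneous_one _ _
    · simpa using hedge _ _
  rcases Int.units_eq_one_or (Equiv.Perm.sign σ) with h | h
  · simpa [h] using hprod
  · simpa [h] using hprod.neg

end Contraction

/-! ### Eisenstein's criterion, the triangle, and the induction -/

section Irreducibility

open MvPolynomial

/-- Eisenstein's criterion for `e X ^ 2 + d` at a prime element. -/
lemma irreducible_quadratic_of_prime {R : Type*} [CommRing R] [IsDomain R] {p d e : R}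
    (hp : Prime p) (hpd : p ∣ d) (hpd2 : ¬ p ^ 2 ∣ d) (hpe : ¬ p ∣ e)
    (hprim : ∀ r, r ∣ d → r ∣ e → IsUnit r) :
    Irreducible (Polynomial.C e * Polynomial.X ^ 2 + Polynomial.C d) := by
  have he : e ≠ 0 := by
    rintro rfl
    exact hpe (dvd_zero p)
  have hdeg : (Polynomial.C e * Polynomial.X ^ 2 + Polynomial.C d).natDegree = 2 := by
    compute_degree!
  have hdeg' : (Polynomial.C e * Polynomial.X ^ 2 + Polynomial.C d).degree = 2 := by
    compute_degree!
  have hP : (Ideal.span {p}).IsPrime := (Ideal.span_singleton_prime hp.ne_zero).2 hp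
  refine Polynomial.irreducible_of_eisenstein_criterion hP ?_ ?_ ?_ ?_ ?_
  · rw [Polynomial.leadingCoeff, hdeg]
    simpa [Ideal.mem_span_singleton, Polynomial.coeff_C] using hpe
  · intro n hn
    rw [hdeg'] at hn
    have hn : n < 2 := by exact_mod_cast hn
    interval_cases n
    · simpa [Ideal.mem_span_singleton] using hpd
    · simp [Polynomial.coeff_X_pow]
  · rw [hdeg']
    norm_num
  · simpa [Ideal.span_singleton_pow, Ideal.mem_span_singleton] using hpd2
  · intro r hr
    rw [Polynomial.C_dvd_iff_dvd_coeff] at hr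
    exact hprim r (by simpa using hr 0) (by simpa [Polynomial.coeff_C] using hr 2)

variable (k : Type*) [Field k]

lemma cayleyMengerMatrix_two (x y z : MvPolynomial (EdgeIndex 3) k)
    (hz : z = edgeVar k 0 1) (hx : x = edgeVar k 1 2) (hy : y = edgeVar k 0 2) :
    cayleyMengerMatrix k 2 =
      !![0, 1, 1, 1; 1, 0, z ^ 2, y ^ 2; 1, z ^ 2, 0, x ^ 2; 1, y ^ 2, x ^ 2, 0] := by
  subst hx hy hz
  ext1 i j
  fin_cases i <;> fin_cases j <;> simp [cayleyMengerMatrix] <;> congr 1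

lemma heron_factorization {S : Type*} [CommRing S] (x y z : S) :
    Matrix.det !![0, 1, 1, 1; 1, 0, z ^ 2, y ^ 2; 1, z ^ 2, 0, x ^ 2; 1, y ^ 2, x ^ 2, 0] =
      -((x + y + z) * (-x + y + z) * (x - y + z) * (x + y - z)) := by
  simp [det_succ_row_zero, Fin.sum_univ_succ, Fin.succAbove]
  ring

lemma cayleyMenger_two : cayleyMenger k 2 =
    -((edgeVar k 1 2 + edgeVar k 0 2 + edgeVar k 0 1) *
      (-edgeVar k 1 2 + edgeVar k 0 2 + edgeVar k 0 1) *
      (edgeVar k 1 2 - edgeVar k 0 2 + edgeVar k 0 1) *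
      (edgeVar k 1 2 + edgeVar k 0 2 - edgeVar k 0 1)) := by
  rw [cayleyMenger, cayleyMengerMatrix_two k _ _ _ rfl rfl rfl, heron_factorization]

lemma facetCayleyMenger_one : facetCayleyMenger k 1 = 2 * edgeVar k 1 2 ^ 2 := by
  rw [facetCayleyMenger, det_fin_three]
  have e1 : (1 : Fin 3) = Fin.succ 0 := rfl
  have e2 : (2 : Fin 3) = Fin.succ 1 := rfl
  rw [e1, e2]
  simp only [bordered_zero_zero, bordered_zero_succ, bordered_succ_zero, bordered_succ_succ,
    edgeVar_self, edgeVar_comm k (Fin.succ (1 : Fin 2)) (Fin.succ 0)]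
  ring

/-- Values of the three indeterminates of a triangle. -/
def triangleValues {k : Type*} (x y z : k) (e : EdgeIndex 3) : k :=
  if e.1.1 = 1 then x else if e.1.2 = 2 then y else z

lemma eval_triangleValues (x y z : k) :
    eval (triangleValues x y z) (edgeVar k 1 2) = x ∧
      eval (triangleValues x y z) (edgeVar k 0 2) = y ∧
      eval (triangleValues x y z) (edgeVar k 0 1) = z := by
  simp [edgeVar, triangleValues]

variable {k}

lemma prime_perimeter :
    Prime (edgeVar k (1 : Fin 3) 2 + edgeVar k 0 2 + edgeVar k 0 1) := by
  set p := edgeVar k (1 : Fin 3) 2 + edgeVar k 0 2 + edgeVar k 0 1 with hp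
  have hp0 : p ≠ 0 := by
    intro h
    have := congrArg (eval (triangleValues (1 : k) 0 0)) h
    simp [hp, eval_triangleValues] at this
  have hhom : p.IsHomogeneous 1 := by
    have h {i j : Fin 3} (hij : i < j) : (edgeVar k i j).IsHomogeneous 1 := by
      rw [edgeVar_of_lt k hij]
      exact isHomogeneous_X _ _
    exact ((h (by decide)).add (h (by decide))).add (h (by decide))
  refine (irreducible_of_totalDegree_eq_one (hhom.totalDegree hp0) fun x hx => ?_).prime
  refine IsUnit.mk0 x ?_
  rintro rfl
  refine hp0 (MvPolynomial.ext _ _ fun m => ?_)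
  simpa using hx m

lemma irreducible_contractedFactor_one (h2 : (2 : k) ≠ 0) :
    Irreducible (contractedFactor k 1) := by
  rw [← MulEquiv.irreducible_iff (optionEquivLeft k (EdgeIndex 3)),
    optionEquivLeft_contractedFactor]
  have h2u : IsUnit (2 : MvPolynomial (EdgeIndex 3) k) := by
    have := (IsUnit.mk0 _ h2).map (C : k →+* MvPolynomial (EdgeIndex 3) k)
    rwa [map_ofNat] at this
  have hev (x y z : k) {p q : MvPolynomial (EdgeIndex 3) k} (h : p ∣ q) :
      eval (triangleValues x y z) p ∣ eval (triangleValues x y z) q := map_dvd _ h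
  have E (x y z : k) := eval_triangleValues k x y z
  refine irreducible_quadratic_of_prime (prime_perimeter (k := k)) ?_ ?_ ?_ ?_
  · rw [cayleyMenger_two]
    refine Dvd.dvd.mul_left ((dvd_neg).2 ?_) _
    rw [mul_assoc, mul_assoc]
    exact dvd_mul_right _ _
  · rw [h2u.dvd_mul_left, cayleyMenger_two, dvd_neg, mul_assoc, mul_assoc, pow_two,
      mul_dvd_mul_iff_left prime_perimeter.ne_zero, prime_perimeter.dvd_mul,
      prime_perimeter.dvd_mul]
    -- Each evaluation point is a zero of the perimeter where the other linear factor takes the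
    -- value 2 or -2.
    rintro (h | h | h)
    · have := hev 1 (-1) 0 h
      simp [E] at this
      exact h2 (by linear_combination -this)
    · have := hev 1 (-1) 0 h
      simp [E] at this
      exact h2 (by linear_combination this)
    · have := hev 1 0 (-1) h
      simp [E] at this
      exact h2 (by linear_combination this)
  · rw [facetCayleyMenger_one, h2u.dvd_mul_left]
    intro h
    have := hev 1 (-1) 0 h
    simp [E] at this
  · intro r hd he
    rw [facetCayleyMenger_one, h2u.dvd_mul_left, edgeVar_of_lt k (by decide)] at he
    rw [h2u.dvd_mul_left, cayleyMenger_two] at hd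
    obtain ⟨i, -, hi⟩ := (dvd_prime_pow X_prime 2).1 he
    rcases Nat.eq_zero_or_pos i with rfl | hi0
    · exact associated_one_iff_isUnit.1 (by simpa using hi)
    · have := hev 0 1 0 (((dvd_pow_self _ hi0.ne').trans hi.symm.dvd).trans hd)
      rw [← edgeVar_of_lt k (by decide)] at this
      simp [E] at this

lemma isUnit_iff_totalDegree_eq_zero {σ : Type*} {p : MvPolynomial σ k} (hp : p ≠ 0) :
    IsUnit p ↔ p.totalDegree = 0 := by
  refine ⟨fun h => (isUnit_iff_totalDegree_of_isReduced.1 h).2, fun h => ?_⟩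
  rw [totalDegree_eq_zero_iff_eq_C] at h
  rw [h] at hp ⊢
  exact (IsUnit.mk0 _ fun h0 => hp (by rw [h0, C_0])).map C

lemma totalDegree_cayleyMenger (h2 : (2 : k) ≠ 0) (n : ℕ) :
    (cayleyMenger k n).totalDegree = 2 * n :=
  (isHomogeneous_cayleyMenger k n).totalDegree (cayleyMenger_ne_zero h2 n)

lemma facetCayleyMenger_ne_zero (h2 : (2 : k) ≠ 0) (q : ℕ) : facetCayleyMenger k q ≠ 0 := by
  obtain ⟨g, hg, e⟩ := facetCayleyMenger_eq_rename k q
  rw [e, Ne, map_eq_zero_iff _ (rename_injective g hg)]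
  exact cayleyMenger_ne_zero h2 q

/-- Eisenstein applies at `cayleyMenger k (q + 1)` itself: its degree 2(q + 1) is too large for it
to divide the facet polynomial, of degree 2q. -/
lemma irreducible_contractedFactor (h2 : (2 : k) ≠ 0) (q : ℕ)
    (h : Irreducible (cayleyMenger k (q + 1))) : Irreducible (contractedFactor k q) := by
  rw [← MulEquiv.irreducible_iff (optionEquivLeft k (EdgeIndex (q + 2))),
    optionEquivLeft_contractedFactor]
  have h2u : IsUnit (2 : MvPolynomial (EdgeIndex (q + 2)) k) := by
    have := (IsUnit.mk0 _ h2).map (C : k →+* MvPolynomial (EdgeIndex (q + 2)) k)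
    rwa [map_ofNat] at this
  have hndvd : ¬ cayleyMenger k (q + 1) ∣ facetCayleyMenger k q := by
    intro hd
    have h1 := totalDegree_le_of_dvd_of_isDomain hd (facetCayleyMenger_ne_zero h2 q)
    obtain ⟨g, hg, e⟩ := facetCayleyMenger_eq_rename k q
    rw [e, totalDegree_cayleyMenger h2] at h1
    have h3 := totalDegree_rename_le g (cayleyMenger k q)
    rw [totalDegree_cayleyMenger h2] at h3
    omega
  refine irreducible_quadratic_of_prime h.prime (dvd_mul_left _ _) ?_ hndvd ?_
  · rw [h2u.dvd_mul_left, pow_two]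
    intro hd
    exact h.not_isUnit (isUnit_of_dvd_one
      ((mul_dvd_mul_iff_left h.ne_zero).1 (by simpa using hd)))
  · intro r hd he
    rw [h2u.dvd_mul_left] at hd
    rcases h.dvd_iff.1 hd with hu | ha
    · exact hu
    · exact absurd (ha.dvd.trans he) hndvd

lemma contractedFactor_ne_zero (h2 : (2 : k) ≠ 0) (q : ℕ) : contractedFactor k q ≠ 0 := by
  intro h
  have h3 := congrArg (fun p => (optionEquivLeft k _ p).coeff 2) h
  simp [optionEquivLeft_contractedFactor] at h3
  exact facetCayleyMenger_ne_zero h2 q h3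

/-- Renaming preserves homogeneity, so the degree can only drop if the image vanishes. -/
lemma totalDegree_rename_contract_cayleyMenger (h2 : (2 : k) ≠ 0) (q : ℕ)
    (τ : Equiv.Perm (Fin (q + 3))) :
    (rename (edgeMap fun i => Fin.predAbove 0 (τ i)) (cayleyMenger k (q + 2))).totalDegree =
      2 * (q + 2) := by
  refine (isHomogeneous_cayleyMenger k (q + 2)).rename_isHomogeneous.totalDegree ?_
  rw [rename_contract_cayleyMenger]
  exact neg_ne_zero.2 (mul_ne_zero (pow_ne_zero 2 (X_ne_zero _)) (contractedFactor_ne_zero h2 q))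

lemma totalDegree_contractedFactor (h2 : (2 : k) ≠ 0) (q : ℕ) :
    (contractedFactor k q).totalDegree = 2 * (q + 1) := by
  have h := totalDegree_rename_contract_cayleyMenger h2 q 1
  rw [rename_contract_cayleyMenger, totalDegree_neg, totalDegree_mul_of_isDomain
    (pow_ne_zero 2 (X_ne_zero _)) (contractedFactor_ne_zero h2 q), totalDegree_X_pow] at h
  omega

/-- The indicator of the edge joining the first two vertices, seen through two contractions. -/
lemma indicator_contract {m : ℕ} (e : EdgeIndex (m + 4)) :
    (edgeMap (Fin.predAbove (0 : Fin (m + 3))) e = none ↔ e.1.1 = 0 ∧ e.1.2 = 1) ∧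
      (edgeMap (fun i => Fin.predAbove (0 : Fin (m + 3)) (Fin.revPerm i)) e =
        some ⟨(⟨m + 1, by omega⟩, ⟨m + 2, by omega⟩), by simp⟩ ↔ e.1.1 = 0 ∧ e.1.2 = 1) := by
  obtain ⟨⟨⟨a, ha⟩, ⟨b, hb⟩⟩, h⟩ := e
  have hp (c : ℕ) (hc : c < m + 4) :
      (Fin.predAbove (0 : Fin (m + 3)) ⟨c, hc⟩).val = c - 1 := by
    cases c with
    | zero => rfl
    | succ c => exact congrArg Fin.val (Fin.predAbove_zero_succ (i := ⟨c, by omega⟩))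
  have h' : a < b := h
  constructor
  · simp only [edgeMap]
    split_ifs with h1 h2 <;> simp only [Fin.lt_def, hp] at h1 <;> simp [Fin.ext_iff]
    · omega
    · simp only [Fin.lt_def, hp] at h2
      omega
    · simp only [Fin.lt_def, hp] at h2
      omega
  · simp only [edgeMap, Fin.revPerm_apply, Fin.rev]
    split_ifs with h1 h2 <;> simp only [Fin.lt_def, hp] at h1 <;>
      simp [Fin.ext_iff, hp]
    · omega
    · omega
    · simp only [Fin.lt_def, hp] at h2
      omega

lemma irreducible_cayleyMenger_of_contractedFactor (h2 : (2 : k) ≠ 0) (q : ℕ) (hq : 1 ≤ q)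
    (h : Irreducible (contractedFactor k q)) : Irreducible (cayleyMenger k (q + 2)) := by
  obtain ⟨m, rfl⟩ : ∃ m, q = m + 1 := ⟨q - 1, by omega⟩
  set M := cayleyMenger k (m + 1 + 2) with hM
  have hM0 : M ≠ 0 := cayleyMenger_ne_zero h2 _
  have hMdeg : M.totalDegree = 2 * (m + 1 + 2) := totalDegree_cayleyMenger h2 _
  refine ⟨fun hu => ?_, fun f g hfg => ?_⟩
  · rw [isUnit_iff_totalDegree_eq_zero hM0] at hu
    omega
  wlog hle : f.totalDegree ≤ g.totalDegree generalizing f g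
  · exact (this g f (by rw [hfg, mul_comm]) (by omega)).symm
  left
  by_contra hf
  have hf0 : f ≠ 0 := by
    rintro rfl
    exact hM0 (by simpa using hfg)
  have hg0 : g ≠ 0 := by
    rintro rfl
    exact hM0 (by simpa using hfg)
  have hdeg : f.totalDegree + g.totalDegree = 2 * (m + 1 + 2) := by
    rw [← totalDegree_mul_of_isDomain hf0 hg0, ← hfg, hMdeg]
  have hP0 := h.ne_zero
  have hPdeg := totalDegree_contractedFactor h2 (m + 1)
  rw [isUnit_iff_totalDegree_eq_zero hf0] at hf
  have key (τ : Equiv.Perm (Fin (m + 4))) :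
      rename (edgeMap fun i => Fin.predAbove 0 (τ i)) f ∣ X none ^ 2 ∧
      X none ∣ rename (edgeMap fun i => Fin.predAbove 0 (τ i)) f := by
    set φ := rename (R := k) (edgeMap fun i : Fin (m + 4) => Fin.predAbove 0 (τ i)) with hφ
    have hfg' : φ f * φ g = -(X none ^ 2 * contractedFactor k (m + 1)) := by
      rw [← map_mul, ← hfg, hM, hφ, rename_contract_cayleyMenger]
    have hne : φ f * φ g ≠ 0 := by
      rw [hfg']
      exact neg_ne_zero.2 (mul_ne_zero (pow_ne_zero 2 (X_ne_zero _)) hP0)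
    have hdf : (φ f).totalDegree ≤ f.totalDegree := totalDegree_rename_le _ _
    have hdg : (φ g).totalDegree ≤ g.totalDegree := totalDegree_rename_le _ _
    have hsum : (φ f).totalDegree + (φ g).totalDegree = 2 * (m + 1 + 2) := by
      rw [← totalDegree_mul_of_isDomain (left_ne_zero_of_mul hne) (right_ne_zero_of_mul hne),
        ← map_mul, ← hfg, hφ, hM, totalDegree_rename_contract_cayleyMenger h2]
    -- deg f ≤ m + 3 < 2(m + 2) = deg P; this is where q ≥ 1 is needed.
    have hPf : ¬ contractedFactor k (m + 1) ∣ φ f := fun hd => by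
      have := totalDegree_le_of_dvd_of_isDomain hd (left_ne_zero_of_mul hne)
      omega
    have hdvd : contractedFactor k (m + 1) ∣ φ f * φ g := by
      rw [hfg', dvd_neg]
      exact dvd_mul_left _ _
    obtain ⟨c, hc⟩ := (h.prime.dvd_or_dvd hdvd).resolve_left hPf
    have hfc : φ f ∣ X none ^ 2 := by
      refine ⟨-c, mul_right_cancel₀ hP0 ?_⟩
      rw [hc] at hfg'
      linear_combination hfg'
    refine ⟨hfc, ?_⟩
    obtain ⟨i, -, hi⟩ := (dvd_prime_pow X_prime 2).1 hfc
    rcases Nat.eq_zero_or_pos i with rfl | hi0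
    · have hu : IsUnit (φ f) := associated_one_iff_isUnit.1 (by simpa using hi)
      rw [isUnit_iff_totalDegree_eq_zero (left_ne_zero_of_mul hne)] at hu
      omega
    · exact (dvd_pow_self _ hi0.ne').trans hi.symm.dvd
  -- Both points pull back to the indicator of edge {0, 1}: p through contracting that edge, q
  -- through contracting the last two vertices, where t = 0.
  let p : Option (EdgeIndex (m + 3)) → k := fun e => if e = none then 1 else 0
  let q : Option (EdgeIndex (m + 3)) → k := fun e =>
    if e = some ⟨(⟨m + 1, by omega⟩, ⟨m + 2, by omega⟩), by simp⟩ then 1 else 0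
  have h1 := map_dvd (eval p) (key 1).1
  have h3 := map_dvd (eval q) (key Fin.revPerm).2
  rw [eval_rename] at h1 h3
  have hpq : p ∘ (edgeMap fun i => Fin.predAbove 0 ((1 : Equiv.Perm (Fin (m + 4))) i)) =
      q ∘ (edgeMap fun i => Fin.predAbove 0 (Fin.revPerm i)) := by
    funext e
    simp only [Function.comp_apply, p, q, (indicator_contract e).2, Equiv.Perm.coe_one, id]
    exact if_congr (indicator_contract e).1 rfl rfl
  rw [hpq] at h1
  have hq0 : q none = 0 := if_neg (by simp)
  rw [eval_X, hq0, zero_dvd_iff] at h3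
  rw [h3] at h1
  simp [p] at h1

lemma irreducible_cayleyMenger (h2 : (2 : k) ≠ 0) (q : ℕ) (hq : 1 ≤ q) :
    Irreducible (cayleyMenger k (q + 2)) := by
  induction q, hq using Nat.le_induction with
  | base =>
    exact irreducible_cayleyMenger_of_contractedFactor h2 1 le_rfl
      (irreducible_contractedFactor_one h2)
  | succ q hq ih =>
    exact irreducible_cayleyMenger_of_contractedFactor h2 (q + 1) (by omega)
      (irreducible_contractedFactor h2 (q + 1) ih)

lemma isReducible_cayleyMenger_two (h2 : (2 : k) ≠ 0) : IsReducible (cayleyMenger k 2) := by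
  have hnu (p : MvPolynomial (EdgeIndex 3) k) (hp : eval (fun _ => 0) p = 0) : ¬ IsUnit p :=
    fun h => (h.map (eval fun _ : EdgeIndex 3 => (0 : k))).ne_zero hp
  refine ⟨cayleyMenger_ne_zero h2 2, _, _, ?_, ?_,
    (cayleyMenger_two k).trans (neg_mul_eq_mul_neg _ _)⟩
  · exact hnu _ (by simp [edgeVar])
  · exact hnu _ (by simp [edgeVar])

end Irreducibility

theorem theorem3p6 (k : Type*) [Field k] (hk : ringChar k ≠ 2) (n : ℕ) (hn : 2 ≤ n) :
    (cayleyMenger k n ≠ 0 ∧ (cayleyMenger k n).IsHomogeneous (2 * n)) ∧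
    (IsReducible (cayleyMenger k n) ↔ n = 2) ∧
    (∀ x y z : MvPolynomial (EdgeIndex 3) k,
      z = edgeVar k 0 1 → x = edgeVar k 1 2 → y = edgeVar k 0 2 →
      cayleyMenger k 2 =
        Matrix.det !![0, 1, 1, 1; 1, 0, z ^ 2, y ^ 2; 1, z ^ 2, 0, x ^ 2; 1, y ^ 2, x ^ 2, 0] ∧
      cayleyMenger k 2 = -((x + y + z) * (-x + y + z) * (x - y + z) * (x + y - z))) := by
  have h2 : (2 : k) ≠ 0 := Ring.two_ne_zero hk
  refine ⟨⟨cayleyMenger_ne_zero h2 n, isHomogeneous_cayleyMenger k n⟩, ⟨?_, ?_⟩, ?_⟩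
  · rintro ⟨-, f, g, hf, hg, h⟩
    by_contra hne
    obtain ⟨q, rfl⟩ : ∃ q, n = q + 2 := ⟨n - 2, by omega⟩
    exact ((irreducible_cayleyMenger h2 q (by omega)).isUnit_or_isUnit h).elim hf hg
  · rintro rfl
    exact isReducible_cayleyMenger_two h2
  · intro x y z hz hx hy
    rw [cayleyMenger, cayleyMengerMatrix_two k x y z hz hx hy]
    exact ⟨rfl, heron_factorization x y z⟩
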